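/- **Definitions.** Let $A$ be a finite alphabet with a distinguished letter $0$. An *$\omega$-word* over $A$ is a map $k\mapsto a_k$ from $\mathbb Z$ to $A$ such that, for some $k$, $a_h=0$ for all $h>k$. The *convolution* of $n$ $\omega$-words over $A$ is the $\omega$-word over $A^n$ obtained by reading them in parallel. A (nondeterministic) Büchi automaton with finitely many states starts in a start state at an arbitrary position $k$ such that $a_h=0$ for all $h\ge k$, reads $a_k,a_{k-1},a_{k-2},\dots$, and accepts if some run visits accepting states infinitely often; it recognises a set $L$ of $\omega$-words if for every $\omega$-word $w$ and every such $k$ it accepts $w$ from $k$ iff $w\in L$. A set of $\omega$-words recognised in this way is called *$\omega$-regular*. An *$\omega$-automatic representation of the reals* consists of a finite alphabet $A$, an $\omega$-regular set $D$ of $\omega$-words over $A$ and a surjective value map $D\to\mathbb R$ such that equality is $\omega$-automatic; here a relation $P\subseteq\mathbb R^n$ is *$\omega$-automatic* if the set of convolutions of all $(x_1,\dots,x_n)\in D^n$ whose values are in $P$ is $\omega$-regular, and a function $f:\mathbb R^n\to\mathbb R$ is *$\omega$-automatic* if its graph $\{(r_1,\dots,r_n,s): f(r_1,\dots,r_n)=s\}$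 is. **Theorem.** Let $b\ge 2$ be an integer. 1. There is an $\omega$-automatic representation of the reals in which addition, subtraction and the comparisons $<,\le,=$ are $\omega$-automatic and in which, for every constant $c\in\mathbb Q[\sqrt b]$, the unary function $x\mapsto c\cdot x$ is $\omega$-automatic. 2. If $b$ is not a perfect square, then there are integers $d,e>3$ with $d^2=be^2+1$, and for all such $d,e$ and $u=d+e\sqrt b$ the following hold. * For every $N\in\mathbb N$, the series $\sum_{k\in\mathbb Z}a_ku^k$ converges absolutely for every $\omega$-word of integer digits with $|a_k|\le N$. * A representation as in part 1 is obtained by taking as $D$ the set of all $\omega$-words of integer digits with $|a_k|\le 2d$, and $\sum_{k\in\mathbb Z}a_ku^k$ as the value of such a word. In particular every real number equals $\sum_{k\in\mathbb Z}a_ku^k$ for some such word. * There is a deterministic Büchi automaton with finitely many states and two sets of accepting states (for positive and negative acceptance) which detects the sign of the value of $\omega$-words of integer digits with $|a_k|\le 6d$: a word is accepted positively iff $\sum_k a_ku^k>0$, accepted negatively iff $\sum_k a_ku^k<0$, and hence rejected iff $\sum_k a_ku^k=0$. -/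

import Mathlib

open Filter

/-- An `ω`-word over an alphabet `A` with a distinguished letter `0`: a map `k ↦ a_k` from `ℤ` to
`A` for which some `k` satisfies `a_h = 0` for all `h > k`. -/
@[ext]
structure OmegaWord (A : Type) [Zero A] where
  digit : ℤ → A
  eventually_zero : ∃ k : ℤ, ∀ h : ℤ, k < h → digit h = 0

/-- The convolution of `n` words over `A`, a word over the alphabet `Fin n → A`. All words have
the full domain `ℤ`, so that no padding symbol is needed. -/
def OmegaWord.conv {A : Type} [Zero A] {n : ℕ} (x : Fin n → OmegaWord A) :
    OmegaWord (Fin n → A) where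
  digit k := fun i => (x i).digit k
  eventually_zero := by
    choose K hK using fun i => (x i).eventually_zero
    obtain ⟨M, hM⟩ := (Set.finite_range K).bddAbove
    exact ⟨M, fun h hh => funext fun i =>
      hK i h (lt_of_le_of_lt (hM (Set.mem_range_self i)) hh)⟩

/-- The (nondeterministic) Büchi automaton `M`, put in a start state at position `k` and reading
`a_k, a_(k-1), a_(k-2), …`, has a run that visits accepting states infinitely often. -/
def BuchiAcceptsFrom {A σ : Type} [Zero A] (M : NFA A σ) (w : OmegaWord A) (k : ℤ) : Prop :=
  ∃ r : ℕ → σ, r 0 ∈ M.start ∧ (∀ n : ℕ, r (n + 1) ∈ M.step (r n) (w.digit (k - n))) ∧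
    ∃ᶠ n in atTop, r n ∈ M.accept

/-- `M` recognises the set `L` of `ω`-words. The automaton may be started at an arbitrary position
`k` such that all `a_h` with `h ≥ k` are `0`, and the outcome is the same for all such `k`. -/
def BuchiRecognizes {A σ : Type} [Zero A] (M : NFA A σ) (L : Set (OmegaWord A)) : Prop :=
  ∀ (w : OmegaWord A) (k : ℤ), (∀ h : ℤ, k ≤ h → w.digit h = 0) →
    (w ∈ L ↔ BuchiAcceptsFrom M w k)

/-- A set of `ω`-words is `ω`-regular if a Büchi automaton with finitely many states
recognises it. -/
def OmegaRegular {A : Type} [Zero A] (L : Set (OmegaWord A)) : Prop :=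
  ∃ (σ : Type) (_ : Finite σ) (M : NFA A σ), BuchiRecognizes M L

/-- A way of naming real numbers by `ω`-words: a set of words and the value of each word. -/
structure RealNaming (A : Type) [Zero A] where
  domain : Set (OmegaWord A)
  value : OmegaWord A → ℝ

namespace RealNaming

variable {A : Type} [Zero A]

/-- An `n`-ary relation on the reals is `ω`-automatic if the convolutions of all tuples of names
whose values are in the relation form an `ω`-regular set. -/
def AutomaticRel (R : RealNaming A) {n : ℕ} (P : (Fin n → ℝ) → Prop) : Prop :=
  OmegaRegular (OmegaWord.conv ''
    {x : Fin n → OmegaWord A | (∀ i, x i ∈ R.domain) ∧ P (fun i => R.value (x i))})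

/-- An `n`-ary function on the reals is `ω`-automatic if its graph, the relation
`f (x_1, …, x_n) = y` between `x_1, …, x_n, y`, is `ω`-automatic. -/
def AutomaticFun (R : RealNaming A) {n : ℕ} (f : (Fin n → ℝ) → ℝ) : Prop :=
  R.AutomaticRel (fun v : Fin (n + 1) → ℝ => f (fun i => v i.castSucc) = v (Fin.last n))

/-- `R` is an `ω`-automatic representation of the reals: the alphabet is finite, the set of names
is `ω`-regular, every real number has a name, and it is `ω`-automatic whether two names denote
the same number. -/
def IsAutomaticRepresentation (R : RealNaming A) : Prop :=
  Finite A ∧ OmegaRegular R.domain ∧ (∀ x : ℝ, ∃ w ∈ R.domain, R.value w = x) ∧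
    R.AutomaticRel (fun v : Fin 2 → ℝ => v 0 = v 1)

/-- `R` is an `ω`-automatic representation of the reals in which addition, subtraction, the
comparisons and the multiplication with each constant from `C` are `ω`-automatic. -/
def IsAutomaticWithConstants (R : RealNaming A) (C : Set ℝ) : Prop :=
  R.IsAutomaticRepresentation ∧
    R.AutomaticFun (fun v : Fin 2 → ℝ => v 0 + v 1) ∧
    R.AutomaticFun (fun v : Fin 2 → ℝ => v 0 - v 1) ∧
    R.AutomaticRel (fun v : Fin 2 → ℝ => v 0 < v 1) ∧
    R.AutomaticRel (fun v : Fin 2 → ℝ => v 0 ≤ v 1) ∧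
    ∀ c ∈ C, R.AutomaticFun (fun v : Fin 1 → ℝ => c * v 0)

end RealNaming

/-- The integer digits of absolute value at most `N`. -/
abbrev Digit (N : ℕ) : Type := {a : ℤ // |a| ≤ (N : ℤ)}

instance Digit.instZero (N : ℕ) : Zero (Digit N) := ⟨⟨0, by simp⟩⟩

/-- The value `∑ a_k u^k`, over all `k ∈ ℤ`, of a word of integer digits in base `u`. -/
noncomputable def baseValue {N : ℕ} (u : ℝ) (w : OmegaWord (Digit N)) : ℝ :=
  ∑' k : ℤ, ((w.digit k : ℤ) : ℝ) * u ^ k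

/-- Base `u`, with all words of integer digits of absolute value at most `N` as names. -/
noncomputable def baseNaming (N : ℕ) (u : ℝ) : RealNaming (Digit N) where
  domain := Set.univ
  value := baseValue u

/-- A deterministic automaton with two sets of accepting states, one for positive and one for
negative acceptance. -/
structure SignAutomaton (A σ : Type) where
  step : σ → A → σ
  start : σ
  pos : Set σ
  neg : Set σ

/-- The automaton recognises, by Büchi acceptance, the sign of the value of an `ω`-word: the words
of positive value are those accepted positively, the words of negative value are those accepted
negatively, so that the words of value zero are those that are rejected. -/
def SignAutomaton.DetectsSign {A σ : Type} [Zero A] (M : SignAutomaton A σ)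
    (value : OmegaWord A → ℝ) : Prop :=
  BuchiRecognizes (DFA.mk M.step M.start M.pos).toNFA {w | 0 < value w} ∧
    BuchiRecognizes (DFA.mk M.step M.start M.neg).toNFA {w | value w < 0}

/-!
Let `d ^ 2 = b * e ^ 2 + 1`. The base `u = d + e√b` is a unit of `ℤ[√b]` whose conjugate `1 / u` is
smaller than `1`. An automaton that reads the digits of an expansion in base `u` from the top keeps
the integer part `s ∈ ℤ[√b]` read so far, which a digit `a` turns into `u * s + a`. The conjugates
of all these integer parts are bounded, as multiplication by `1 / u` is a contraction. The integer
parts themselves either stay bounded, in which case the value is `0`, or become so large that the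
remaining digits cannot change the sign any more. Only finitely many elements of `ℤ[√b]` are bounded
together with their conjugates, so that finitely many states suffice to detect the sign
(`eventually_verdict`, `exists_signAutomaton`).

The digits may themselves be taken from a finite subset of `ℤ[√b]`. A linear form with coefficients
in `ℤ[√b]`, applied to several words, is therefore the value of a single word over the product
alphabet, and every comparison of a linear form with `0` is `ω`-automatic
(`automaticRel_linearForm`). Addition, subtraction, the comparisons, and `x ↦ c * x` for
`c ∈ ℚ[√b]`, written as `r * c = s` with `r, s ∈ ℤ[√b]`, are all of this form.

Every real number has a name because `u < 2 * d`: splitting off integer parts yields digits between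
`-1` and `2 * d - 1` (`exists_baseValue_eq`). If `b` is a square, then `ℚ[√b]` is contained in
`ℚ[√2]`, and the base `3 + 2√2` gives the representation.
-/

/-! ### Expansions in a real base -/

/-- The value `∑ g_i u^(-(i+1))` of a sequence of digits standing behind the radix point, the most
significant one first. -/
noncomputable def fractionValue (u : ℝ) (g : ℕ → ℝ) : ℝ :=
  ∑' i : ℕ, g i * u⁻¹ ^ (i + 1)

theorem summable_fraction {u N : ℝ} (hu : 1 < u) {g : ℕ → ℝ} (hg : ∀ i, |g i| ≤ N) :
    Summable fun i : ℕ => g i * u⁻¹ ^ (i + 1) := by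
  have h0 : 0 < u⁻¹ := by positivity
  have hgeo := (summable_geometric_of_lt_one h0.le (inv_lt_one_of_one_lt₀ hu)).mul_right (N * u⁻¹)
  refine Summable.of_norm_bounded hgeo fun i => ?_
  rw [Real.norm_eq_abs, abs_mul, abs_of_pos (pow_pos h0 _)]
  calc |g i| * u⁻¹ ^ (i + 1) ≤ N * u⁻¹ ^ (i + 1) := by gcongr; exact hg i
    _ = u⁻¹ ^ i * (N * u⁻¹) := by ring

theorem mul_fractionValue {u N : ℝ} (hu : 1 < u) {g : ℕ → ℝ} (hg : ∀ i, |g i| ≤ N) :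
    u * fractionValue u g = g 0 + fractionValue u fun i => g (i + 1) := by
  have hu0 : u ≠ 0 := by positivity
  rw [fractionValue, (summable_fraction hu hg).tsum_eq_zero_add, mul_add, ← tsum_mul_left,
    fractionValue]
  congr 1
  · rw [zero_add, pow_one]
    field_simp
  · refine tsum_congr fun i => ?_
    rw [pow_succ _ (i + 1)]
    field_simp

theorem abs_fractionValue_le {u N : ℝ} (hu : 1 < u) {g : ℕ → ℝ} (hg : ∀ i, |g i| ≤ N) :
    |fractionValue u g| ≤ N / (u - 1) := by
  have h0 : 0 < u⁻¹ := by positivity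
  have hgeo := (hasSum_geometric_of_lt_one h0.le (inv_lt_one_of_one_lt₀ hu)).mul_right (N * u⁻¹)
  have hval : (1 - u⁻¹)⁻¹ * (N * u⁻¹) = N / (u - 1) := by
    have : u - 1 ≠ 0 := by linarith
    have : u ≠ 0 := by positivity
    have : 1 - u⁻¹ ≠ 0 := by
      have := inv_lt_one_of_one_lt₀ hu
      linarith
    field_simp
  rw [hval] at hgeo
  rw [← Real.norm_eq_abs]
  refine tsum_of_norm_bounded hgeo fun i => ?_
  rw [Real.norm_eq_abs, abs_mul, abs_of_pos (pow_pos h0 _)]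
  calc |g i| * u⁻¹ ^ (i + 1) ≤ N * u⁻¹ ^ (i + 1) := by gcongr; exact hg i
    _ = u⁻¹ ^ i * (N * u⁻¹) := by ring

/-- The value of a sequence of digits, scaled by `u ^ n`, is the integer part read by Horner's rule
plus the value of the digits not yet read. -/
theorem pow_mul_fractionValue {u N : ℝ} (hu : 1 < u) {g : ℕ → ℝ} (hg : ∀ i, |g i| ≤ N)
    {s : ℕ → ℝ} (hs0 : s 0 = 0) (hs : ∀ n, s (n + 1) = u * s n + g n) (n : ℕ) :
    u ^ n * fractionValue u g = s n + fractionValue u fun i => g (i + n) := by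
  induction n with
  | zero => simp [hs0]
  | succ n ih =>
    have h := mul_fractionValue hu (g := fun i => g (i + n)) fun i => hg _
    rw [pow_succ', mul_assoc, ih, mul_add, h, hs]
    simp only [zero_add, add_right_comm _ 1 n, ← add_assoc]

theorem sign_fractionValue {u N : ℝ} (hu : 1 < u) {g : ℕ → ℝ} (hg : ∀ i, |g i| ≤ N)
    {s : ℕ → ℝ} (hs0 : s 0 = 0) (hs : ∀ n, s (n + 1) = u * s n + g n) {n : ℕ}
    (hn : N / (u - 1) < |s n|) : SignType.sign (fractionValue u g) = SignType.sign (s n) := by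
  have h := pow_mul_fractionValue hu hg hs0 hs n
  have hT := abs_le.1 (abs_fractionValue_le hu (g := fun i => g (i + n)) fun i => hg _)
  have hpow : 0 < u ^ n := by positivity
  rcases lt_abs.1 hn with hpos | hneg
  · have h1 : 0 < u ^ n * fractionValue u g := by linarith
    have hN : 0 ≤ N / (u - 1) := by linarith
    rw [sign_pos (pos_of_mul_pos_right h1 hpow.le), sign_pos (by linarith)]
  · have h1 : u ^ n * fractionValue u g < 0 := by linarith
    have hN : 0 ≤ N / (u - 1) := by linarith
    rw [sign_neg (neg_of_mul_neg_right h1 hpow.le), sign_neg (by linarith)]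

/-- If the integer parts stay bounded, then so does `u ^ n * fractionValue u g`. -/
theorem fractionValue_eq_zero {u N B : ℝ} (hu : 1 < u) {g : ℕ → ℝ} (hg : ∀ i, |g i| ≤ N)
    {s : ℕ → ℝ} (hs0 : s 0 = 0) (hs : ∀ n, s (n + 1) = u * s n + g n) (hB : ∀ n, |s n| ≤ B) :
    fractionValue u g = 0 := by
  by_contra hne
  have hpos : 0 < |fractionValue u g| := abs_pos.2 hne
  obtain ⟨n, hn⟩ := pow_unbounded_of_one_lt ((B + N / (u - 1)) / |fractionValue u g|) hu
  rw [div_lt_iff₀ hpos] at hn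
  have h := pow_mul_fractionValue hu hg hs0 hs n
  have hT := abs_fractionValue_le hu (g := fun i => g (i + n)) fun i => hg _
  have h2 := abs_add_le (s n) (fractionValue u fun i => g (i + n))
  rw [← h, abs_mul, abs_of_pos (by positivity : 0 < u ^ n)] at h2
  linarith [hB n]

/-- A two-sided expansion without digits above position `k`, read from position `k` downwards. -/
theorem hasSum_expansion {u N : ℝ} (hu : 1 < u) {D : ℤ → ℝ} {k : ℤ} (hD : ∀ h, |D h| ≤ N)
    (hk : ∀ h, k < h → D h = 0) :
    HasSum (fun h : ℤ => D h * u ^ h) (u ^ (k + 1) * fractionValue u fun n => D (k - n)) := by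
  have hu0 : u ≠ 0 := by positivity
  have hinj : Function.Injective fun n : ℕ => k - (n : ℤ) := fun a b h => by
    simpa using h
  rw [← hinj.hasSum_iff]
  · have hterm : (fun h : ℤ => D h * u ^ h) ∘ (fun n : ℕ => k - (n : ℤ)) =
        fun n : ℕ => u ^ (k + 1) * (D (k - n) * u⁻¹ ^ (n + 1)) := by
      funext n
      have : u ^ (k - (n : ℤ)) = u ^ (k + 1) * u⁻¹ ^ (n + 1) := by
        rw [inv_pow, ← zpow_natCast, ← zpow_neg, ← zpow_add₀ hu0]
        congr 1
        push_cast
        ring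
      simp only [Function.comp_apply, this]
      ring
    rw [hterm]
    exact (summable_fraction hu fun n => hD _).hasSum.mul_left _
  · intro h hh
    have : k < h := by
      by_contra hle
      refine hh ⟨(k - h).toNat, ?_⟩
      change k - ((k - h).toNat : ℤ) = h
      omega
    simp [hk h this]

/-- A real number is expanded by splitting off integer parts: if `y (n + 1) = u * fract (y n)`, then
the digits `⌊y n⌋` expand `y 0`, the first of them standing before the radix point. -/
theorem fractionValue_floor {u N : ℝ} (hu : 1 < u) {y : ℕ → ℝ}
    (hy : ∀ n, y (n + 1) = u * Int.fract (y n)) (hN : ∀ n, |(⌊y n⌋ : ℝ)| ≤ N) :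
    u * fractionValue u (fun n => (⌊y n⌋ : ℝ)) = y 0 := by
  -- Scaled by `u ^ n`, the difference of the two sides is the one for the remainder `y n`. It stays
  -- bounded (`hbd`), which forces it to vanish.
  have key : ∀ n, u ^ n * (u * fractionValue u (fun n => (⌊y n⌋ : ℝ)) - y 0) =
      u * fractionValue u (fun i => (⌊y (i + n)⌋ : ℝ)) - y n := by
    intro n
    induction n with
    | zero => simp
    | succ n ih =>
      have h := mul_fractionValue hu (g := fun i => (⌊y (i + n)⌋ : ℝ)) fun i => hN _
      rw [pow_succ', mul_assoc, ih, h, hy n, Int.fract]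
      simp only [zero_add, add_right_comm _ 1 n, ← add_assoc]
      ring
  have hbd : ∀ n, |u * fractionValue u (fun i => (⌊y (i + n)⌋ : ℝ)) - y n| ≤
      u * (N / (u - 1)) + (N + 1) := by
    intro n
    have hT := abs_fractionValue_le hu (g := fun i => (⌊y (i + n)⌋ : ℝ)) fun i => hN _
    have h1 : |u * fractionValue u (fun i => (⌊y (i + n)⌋ : ℝ))| ≤ u * (N / (u - 1)) := by
      rw [abs_mul, abs_of_pos (by positivity : 0 < u)]
      gcongr
    have h2 : |y n| ≤ N + 1 := by
      have h3 := Int.floor_add_fract (y n)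
      have h4 := abs_add_le (⌊y n⌋ : ℝ) (Int.fract (y n))
      rw [h3, Int.abs_fract] at h4
      linarith [hN n, Int.fract_lt_one (y n)]
    exact (abs_sub _ _).trans (add_le_add h1 h2)
  by_contra hne
  have hpos : 0 < |u * fractionValue u (fun n => (⌊y n⌋ : ℝ)) - y 0| :=
    abs_pos.2 (sub_ne_zero.2 hne)
  obtain ⟨n, hn⟩ := pow_unbounded_of_one_lt ((u * (N / (u - 1)) + (N + 1)) / _) hu
  rw [div_lt_iff₀ hpos] at hn
  have h := hbd n
  rw [← key, abs_mul, abs_of_pos (by positivity : 0 < u ^ n)] at h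
  linarith

/-! ### Deterministic runs -/

/-- The run of a deterministic transition function on the letters `a_k, a_(k-1), a_(k-2), …`. -/
def runFrom {A σ : Type} [Zero A] (step : σ → A → σ) (start : σ) (w : OmegaWord A) (k : ℤ) :
    ℕ → σ
  | 0 => start
  | n + 1 => step (runFrom step start w k n) (w.digit (k - n))

theorem buchiAcceptsFrom_toNFA_iff {A σ : Type} [Zero A] (M : DFA A σ) (w : OmegaWord A) (k : ℤ) :
    BuchiAcceptsFrom M.toNFA w k ↔ ∃ᶠ n in atTop, runFrom M.step M.start w k n ∈ M.accept := by
  constructor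
  · rintro ⟨r, h0, hstep, hacc⟩
    have hr : r = runFrom M.step M.start w k := by
      funext n
      induction n with
      | zero => simpa [runFrom] using h0
      | succ n ih =>
        have h := hstep n
        rw [ih] at h
        simpa [runFrom] using h
    rwa [← hr]
  · intro h
    exact ⟨_, by simp [runFrom], fun n => by simp [runFrom], h⟩

/-! ### The sign automaton

The automaton reads the digits of an expansion in base `θ ∈ O` from the top and keeps the integer
part read so far, an element of `O`. It forgets all but the sign as soon as the integer part is too
large for the remaining digits to change the sign. -/

section SignAutomaton

variable {O : Type} [CommRing O] (φ ψ : O →+* ℝ) (B : ℝ)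

/-- The integer parts that are bounded by `B` in both embeddings. -/
abbrev BoundedElements : Type := {s : O // |φ s| ≤ B ∧ |ψ s| ≤ B}

open Classical in
/-- One step of Horner's rule in base `θ`. The states on the left are the bounded integer parts, the
states on the right are absorbing and hold the sign that was found. -/
noncomputable def signStep (θ : O) {A : Type} (δ : A → O) :
    BoundedElements φ ψ B ⊕ SignType → A → BoundedElements φ ψ B ⊕ SignType
  | .inl s, a =>
    if h : |φ (θ * s + δ a)| ≤ B ∧ |ψ (θ * s + δ a)| ≤ B then .inl ⟨θ * s + δ a, h⟩
    else .inr (SignType.sign (φ (θ * s + δ a)))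
  | .inr c, _ => .inr c

/-- The sign announced by a state: `0` as long as the integer part is bounded. -/
def verdict : BoundedElements φ ψ B ⊕ SignType → SignType :=
  Sum.elim (fun _ => 0) id

/-- The integer parts of the word `w` in base `θ`, read from position `k` downwards. -/
def integerPart {O : Type} [CommRing O] (θ : O) {A : Type} (δ : A → O) [Zero A] (w : OmegaWord A)
    (k : ℤ) : ℕ → O
  | 0 => 0
  | n + 1 => θ * integerPart θ δ w k n + δ (w.digit (k - n))

variable {φ ψ B} {θ : O} {A : Type} [Zero A] {δ : A → O} {N : ℝ}

/-- The bound on `ψ` is never violated, so that an absorbing state is entered only when the integer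
part exceeds `B` under `φ`. The remaining digits, worth at most `N / (φ θ - 1)` there, then cannot
change the sign. -/
theorem eventually_verdict (hθ : 1 < φ θ) (hφ : ∀ a, |φ (δ a)| ≤ N) (hψ : ∀ a, |ψ (δ a)| ≤ N)
    (hBφ : N / (φ θ - 1) ≤ B) (hBψ : |ψ θ| * B + N ≤ B)
    (start : BoundedElements φ ψ B) (hstart : (start : O) = 0) (w : OmegaWord A) (k : ℤ) :
    ∀ᶠ n in atTop, verdict φ ψ B (runFrom (signStep φ ψ B θ δ) (.inl start) w k n) =
      SignType.sign (fractionValue (φ θ) fun n => φ (δ (w.digit (k - n)))) := by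
  set r := runFrom (signStep φ ψ B θ δ) (.inl start) w k with hr
  set V := fractionValue (φ θ) fun n => φ (δ (w.digit (k - n))) with hV
  have hs0 : φ (integerPart θ δ w k 0) = 0 := map_zero φ
  have hs : ∀ n, φ (integerPart θ δ w k (n + 1)) =
      φ θ * φ (integerPart θ δ w k n) + φ (δ (w.digit (k - n))) := fun n => by
    rw [integerPart, map_add, map_mul]
  have hg : ∀ n : ℕ, |φ (δ (w.digit (k - n)))| ≤ N := fun n => hφ _
  have hinv : ∀ n, (∀ s, r n = .inl s → (s : O) = integerPart θ δ w k n) ∧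
      ∀ c, r n = .inr c → c = SignType.sign V := by
    intro n
    induction n with
    | zero =>
      refine ⟨fun s h => ?_, fun c h => ?_⟩
      · rw [← Sum.inl.inj h]
        exact hstart
      · cases h
    | succ n ih =>
      have hstep : r (n + 1) = signStep φ ψ B θ δ (r n) (w.digit (k - n)) := rfl
      rcases hrn : r n with s | c
      · have hsn := ih.1 s hrn
        have hnext : θ * (s : O) + δ (w.digit (k - n)) = integerPart θ δ w k (n + 1) := by
          rw [hsn, integerPart]
        rw [hstep, hrn]
        by_cases hb : |φ (θ * s + δ (w.digit (k - n)))| ≤ B ∧ |ψ (θ * s + δ (w.digit (k - n)))| ≤ B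
        · rw [signStep, dif_pos hb]
          refine ⟨fun t h => ?_, fun c h => (by cases h)⟩
          rw [← Sum.inl.inj h]
          exact hnext
        · rw [signStep, dif_neg hb]
          refine ⟨fun t h => (by cases h), fun c h => ?_⟩
          rw [← Sum.inr.inj h]
          have hψs : |ψ (θ * s + δ (w.digit (k - n)))| ≤ B := by
            rw [map_add, map_mul]
            refine (abs_add_le _ _).trans (le_trans ?_ hBψ)
            rw [abs_mul]
            exact add_le_add (mul_le_mul_of_nonneg_left s.2.2 (abs_nonneg _)) (hψ _)
          have hlt : B < |φ (θ * s + δ (w.digit (k - n)))| := by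
            by_contra hle
            exact hb ⟨not_lt.1 hle, hψs⟩
          rw [hnext] at hlt ⊢
          exact (sign_fractionValue hθ hg (s := fun n => φ (integerPart θ δ w k n)) hs0 hs
            (hBφ.trans_lt hlt)).symm
      · rw [hstep, hrn]
        refine ⟨fun t h => (by cases h), fun c' h => ?_⟩
        rw [← Sum.inr.inj h]
        exact ih.2 c hrn
  by_cases hsink : ∃ m c, r m = .inr c
  · obtain ⟨m, c, hm⟩ := hsink
    refine eventually_atTop.2 ⟨m, fun n hn => ?_⟩
    have hstay : r n = .inr c := by
      induction n, hn using Nat.le_induction with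
      | base => exact hm
      | succ n _ ih =>
        have hstep : r (n + 1) = signStep φ ψ B θ δ (r n) (w.digit (k - n)) := rfl
        rw [hstep, ih, signStep]
    rw [hstay]
    exact (hinv n).2 c hstay
  · have hlive : ∀ n, ∃ s, r n = .inl s := fun n => by
      rcases h : r n with s | c
      · exact ⟨s, rfl⟩
      · exact (hsink ⟨n, c, h⟩).elim
    have hV0 : V = 0 := by
      refine fractionValue_eq_zero hθ hg (s := fun n => φ (integerPart θ δ w k n)) hs0 hs
        (B := B) fun n => ?_
      obtain ⟨s, h⟩ := hlive n
      rw [← (hinv n).1 s h]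
      exact s.2.1
    refine Eventually.of_forall fun n => ?_
    obtain ⟨s, h⟩ := hlive n
    rw [h, hV0, sign_zero]
    rfl

/-- One deterministic automaton serves for all sets `S` of signs, with accepting states depending on
`S`, because its verdict converges to the sign of the value. -/
theorem exists_signAutomaton (hθ : 1 < φ θ) (hθ' : |ψ θ| < 1)
    (hfin : ∀ B : ℝ, {s : O | |φ s| ≤ B ∧ |ψ s| ≤ B}.Finite) [Finite A] (hδ : δ 0 = 0) :
    ∃ (σ : Type) (_ : Finite σ) (step : σ → A → σ) (start : σ) (sgn : σ → SignType),
      ∀ S : Set SignType, BuchiRecognizes (DFA.mk step start (sgn ⁻¹' S)).toNFA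
        {w | SignType.sign (∑' k : ℤ, φ (δ (w.digit k)) * φ θ ^ k) ∈ S} := by
  obtain ⟨N₁, hN₁⟩ := (Set.finite_range fun a => |φ (δ a)|).bddAbove
  obtain ⟨N₂, hN₂⟩ := (Set.finite_range fun a => |ψ (δ a)|).bddAbove
  set N := max N₁ N₂
  have hφ : ∀ a, |φ (δ a)| ≤ N := fun a => (hN₁ ⟨a, rfl⟩).trans (le_max_left _ _)
  have hψ : ∀ a, |ψ (δ a)| ≤ N := fun a => (hN₂ ⟨a, rfl⟩).trans (le_max_right _ _)
  have hN : 0 ≤ N := (abs_nonneg _).trans (hφ 0)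
  -- The first bound dominates the unread digits under `φ`, the second is invariant under `ψ`.
  set B := max (N / (φ θ - 1)) (N / (1 - |ψ θ|))
  have hBφ : N / (φ θ - 1) ≤ B := le_max_left _ _
  have hBψ : |ψ θ| * B + N ≤ B := by
    have h : N / (1 - |ψ θ|) ≤ B := le_max_right _ _
    rw [div_le_iff₀ (by linarith)] at h
    linarith
  have hB : 0 ≤ B := (div_nonneg hN (by linarith)).trans hBφ
  have : Finite (BoundedElements φ ψ B) := hfin B
  refine ⟨BoundedElements φ ψ B ⊕ SignType, inferInstance, signStep φ ψ B θ δ,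
    .inl ⟨0, by simpa using hB⟩, verdict φ ψ B, fun S w k hk => ?_⟩
  have hsum := hasSum_expansion hθ (D := fun h => φ (δ (w.digit h))) (k := k) (fun h => hφ _)
    fun h hh => by rw [hk h hh.le, hδ, map_zero]
  have hev := eventually_verdict hθ hφ hψ hBφ hBψ ⟨0, by simpa using hB⟩ rfl w k
  rw [buchiAcceptsFrom_toNFA_iff, Set.mem_ofPred_eq, hsum.tsum_eq, sign_mul,
    sign_pos (zpow_pos (by linarith) _), one_mul]
  constructor
  · intro h
    exact (hev.mono fun n hn => by rw [← hn] at h; exact h).frequently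
  · intro h
    obtain ⟨n, hn, hn'⟩ := (h.and_eventually hev).exists
    rw [← hn']
    exact hn

end SignAutomaton

/-! ### Linear relations between numbers named in base `u` -/

theorem summable_digits {N : ℕ} {u : ℝ} (hu : 1 < u) (w : OmegaWord (Digit N)) :
    Summable fun k : ℤ => ((w.digit k : ℤ) : ℝ) * u ^ k := by
  obtain ⟨k, hk⟩ := w.eventually_zero
  refine (hasSum_expansion (N := N) hu (D := fun h => ((w.digit h : ℤ) : ℝ)) (fun h => ?_)
    (k := k) fun h hh => ?_).summable
  · exact_mod_cast (w.digit h).2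
  · rw [hk h hh]
    exact Int.cast_zero

instance Digit.finite (N : ℕ) : Finite (Digit N) :=
  (Set.finite_Icc (-(N : ℤ)) N).subset fun _ ha => abs_le.1 ha

theorem omegaRegular_univ {A : Type} [Zero A] : OmegaRegular (Set.univ : Set (OmegaWord A)) :=
  ⟨Unit, inferInstance, ⟨fun _ _ => Set.univ, Set.univ, Set.univ⟩, fun _ _ _ =>
    ⟨fun _ => ⟨fun _ => (), trivial, fun _ => trivial, Frequently.of_forall fun _ => trivial⟩,
      fun _ => trivial⟩⟩

theorem OmegaWord.conv_surjective {A : Type} [Zero A] {n : ℕ} :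
    Function.Surjective (OmegaWord.conv : (Fin n → OmegaWord A) → _) := fun w =>
  ⟨fun i => ⟨fun k => w.digit k i, w.eventually_zero.imp fun _ hk h hh => by
    rw [hk h hh]
    rfl⟩, rfl⟩

section Base

variable {O : Type} [CommRing O] {φ ψ : O →+* ℝ} {θ : O}

/-- All relations needed compare a linear form with `0`, and the value of a linear form is the value
of one word, with digits in `O`. -/
theorem automaticRel_linearForm (hθ : 1 < φ θ) (hθ' : |ψ θ| < 1)
    (hfin : ∀ B : ℝ, {s : O | |φ s| ≤ B ∧ |ψ s| ≤ B}.Finite) (N : ℕ) {n : ℕ} (c : Fin n → O)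
    (S : Set SignType) {P : (Fin n → ℝ) → Prop}
    (hP : ∀ v, P v ↔ SignType.sign (∑ i, φ (c i) * v i) ∈ S) :
    (baseNaming N (φ θ)).AutomaticRel P := by
  obtain ⟨σ, hσ, step, start, sgn, h⟩ := exists_signAutomaton hθ hθ' hfin
    (δ := fun a : Fin n → Digit N => ∑ i, c i * ((a i : ℤ) : O))
    (Finset.sum_eq_zero fun i _ => by
      rw [show (((0 : Fin n → Digit N) i : ℤ)) = 0 from rfl, Int.cast_zero, mul_zero])
  refine ⟨σ, hσ, (DFA.mk step start (sgn ⁻¹' S)).toNFA, ?_⟩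
  have hval : ∀ x : Fin n → OmegaWord (Digit N),
      ∑' k : ℤ, φ (∑ i, c i * ((((OmegaWord.conv x).digit k i : Digit N) : ℤ) : O)) * φ θ ^ k =
        ∑ i, φ (c i) * baseValue (φ θ) (x i) := fun x => by
    simp only [baseValue, ← tsum_mul_left]
    rw [← Summable.tsum_finsetSum fun i _ => (summable_digits hθ (x i)).mul_left _]
    refine tsum_congr fun k => ?_
    rw [map_sum, Finset.sum_mul]
    refine Finset.sum_congr rfl fun i _ => ?_
    rw [map_mul, map_intCast, mul_assoc]
    rfl
  convert h S using 1
  ext w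
  obtain ⟨x, rfl⟩ := OmegaWord.conv_surjective w
  constructor
  · rintro ⟨y, ⟨-, hy⟩, hyx⟩
    rw [← hyx]
    change SignType.sign (∑' k : ℤ, _) ∈ S
    rw [hval]
    exact (hP _).1 hy
  · intro hx
    refine ⟨x, ⟨fun i => trivial, (hP _).2 ?_⟩, rfl⟩
    have hx' : SignType.sign (∑' k : ℤ, _) ∈ S := hx
    rwa [hval] at hx'

/-- The digits are found by splitting off integer parts from `x / u ^ K`, for `K` so large that
`|x| < u ^ K`. -/
theorem exists_baseValue_eq {d : ℕ} {u : ℝ} (hu : 1 < u) (hud : u ≤ d) (x : ℝ) :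
    ∃ w : OmegaWord (Digit d), baseValue u w = x := by
  have hu0 : 0 < u := by linarith
  obtain ⟨K, hK⟩ := pow_unbounded_of_one_lt |x| hu
  set y : ℕ → ℝ := fun n => n.rec (x / u ^ K) fun _ y => u * Int.fract y with hy
  have hy0 : y 0 = x / u ^ K := rfl
  have hys : ∀ n, y (n + 1) = u * Int.fract (y n) := fun n => rfl
  have hd1 : (1 : ℝ) ≤ d := hu.le.trans hud
  have hdig : ∀ n, |⌊y n⌋| ≤ (d : ℤ) := by
    intro n
    -- Only the leading remainder can be negative.
    have hbd : -1 ≤ y n ∧ y n < d := by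
      cases n with
      | zero =>
        have hpow : 0 < u ^ K := by positivity
        have h1 : |y 0| < 1 := by
          rw [hy0, abs_div, abs_of_pos hpow, div_lt_one hpow]
          exact hK
        exact ⟨(abs_lt.1 h1).1.le, (abs_lt.1 h1).2.trans_le hd1⟩
      | succ n =>
        rw [hys]
        have h1 := Int.fract_nonneg (y n)
        have h2 := mul_lt_mul_of_pos_left (Int.fract_lt_one (y n)) hu0
        have h3 := mul_nonneg hu0.le h1
        constructor <;> linarith
    have h1 : -1 ≤ ⌊y n⌋ := Int.le_floor.2 (by exact_mod_cast hbd.1)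
    have h2 : ⌊y n⌋ < (d : ℤ) := Int.floor_lt.2 (by exact_mod_cast hbd.2)
    rw [abs_le]
    have : 1 ≤ d := by exact_mod_cast hd1
    omega
  -- The digit `⌊y n⌋` stands at position `K - n`.
  let D : ℤ → Digit d := fun h => if (K : ℤ) < h then 0 else ⟨⌊y (K - h).toNat⌋, hdig _⟩
  have hD0 : ∀ h, (K : ℤ) < h → D h = 0 := fun h hh => if_pos hh
  refine ⟨⟨D, K, hD0⟩, ?_⟩
  have hsum := hasSum_expansion (N := d) hu (D := fun h => ((D h : ℤ) : ℝ)) (k := K)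
    (fun h => by exact_mod_cast (D h).2) fun h hh => by
      rw [hD0 h hh]
      exact Int.cast_zero
  have hDy : (fun n : ℕ => ((D (K - n) : ℤ) : ℝ)) = fun n => (⌊y n⌋ : ℝ) := by
    funext n
    have : D (K - n) = ⟨⌊y n⌋, hdig n⟩ := by
      rw [show D (K - n) = _ from if_neg (by omega)]
      simp
    rw [this]
  rw [hDy] at hsum
  have hfl := fractionValue_floor hu hys (N := d) fun n => by exact_mod_cast hdig n
  refine hsum.tsum_eq.trans ?_
  rw [zpow_add_one₀ hu0.ne', mul_assoc, hfl, hy0, zpow_natCast]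
  field_simp

theorem baseNaming_isAutomaticWithConstants (hθ : 1 < φ θ) (hθ' : |ψ θ| < 1)
    (hfin : ∀ B : ℝ, {s : O | |φ s| ≤ B ∧ |ψ s| ≤ B}.Finite) {N : ℕ} (hN : φ θ ≤ N) {C : Set ℝ}
    (hC : ∀ c ∈ C, ∃ r s : O, φ r ≠ 0 ∧ φ r * c = φ s) :
    (baseNaming N (φ θ)).IsAutomaticWithConstants C := by
  refine ⟨⟨Digit.finite N, omegaRegular_univ, fun x => ?_, ?_⟩, ?_, ?_, ?_, ?_, fun c hc => ?_⟩
  · obtain ⟨w, hw⟩ := exists_baseValue_eq hθ hN x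
    exact ⟨w, trivial, hw⟩
  · refine automaticRel_linearForm hθ hθ' hfin N ![1, -1] {0} fun v => ?_
    simp [Fin.sum_univ_succ, ← sub_eq_add_neg, sub_eq_zero]
  · refine automaticRel_linearForm hθ hθ' hfin N ![1, 1, -1] {0} fun v => ?_
    have h : v 0 + v 1 = v 2 ↔ v 0 + (v 1 + -v 2) = 0 := by
      constructor <;> intro h <;> linarith
    simpa [Fin.sum_univ_succ, Fin.last] using h
  · refine automaticRel_linearForm hθ hθ' hfin N ![1, -1, -1] {0} fun v => ?_
    have h : v 0 - v 1 = v 2 ↔ v 0 + (-v 1 + -v 2) = 0 := by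
      constructor <;> intro h <;> linarith
    simpa [Fin.sum_univ_succ, Fin.last] using h
  · refine automaticRel_linearForm hθ hθ' hfin N ![1, -1] {-1} fun v => ?_
    simp [Fin.sum_univ_succ, sign_eq_neg_one_iff, ← sub_eq_add_neg]
  · refine automaticRel_linearForm hθ hθ' hfin N ![1, -1] {0, -1} fun v => ?_
    simp [Fin.sum_univ_succ, sign_eq_neg_one_iff, ← sub_eq_add_neg, sub_eq_zero, le_iff_eq_or_lt]
  · obtain ⟨r, s, hr, hrs⟩ := hC c hc
    refine automaticRel_linearForm hθ hθ' hfin N ![s, -r] {0} fun v => ?_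
    simp [Fin.sum_univ_succ, Fin.last, ← hrs, mul_assoc, ← sub_eq_add_neg, ← mul_sub, hr,
      sub_eq_zero]

theorem baseNaming_detectsSign (hθ : 1 < φ θ) (hθ' : |ψ θ| < 1)
    (hfin : ∀ B : ℝ, {s : O | |φ s| ≤ B ∧ |ψ s| ≤ B}.Finite) (N : ℕ) :
    ∃ (σ : Type) (_ : Finite σ) (M : SignAutomaton (Digit N) σ),
      M.DetectsSign (baseValue (φ θ)) := by
  obtain ⟨σ, hσ, step, start, sgn, h⟩ := exists_signAutomaton hθ hθ' hfin
    (δ := fun a : Digit N => ((a : ℤ) : O)) (Int.cast_zero)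
  refine ⟨σ, hσ, ⟨step, start, sgn ⁻¹' {1}, sgn ⁻¹' {-1}⟩, ?_, ?_⟩
  · convert h {1} using 1
    ext w
    simp [baseValue, sign_eq_one_iff]
  · convert h {-1} using 1
    ext w
    simp [baseValue, sign_eq_neg_one_iff]

end Base

/-! ### Real quadratic integers -/

/-- The embedding of `ℤ√b` into the reals that maps `√b` to the positive root. -/
noncomputable def posEmbedding (b : ℕ) : ℤ√(b : ℤ) →+* ℝ :=
  Zsqrtd.lift ⟨Real.sqrt b, by simp⟩

/-- The embedding of `ℤ√b` into the reals that maps `√b` to the negative root. -/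
noncomputable def negEmbedding (b : ℕ) : ℤ√(b : ℤ) →+* ℝ :=
  Zsqrtd.lift ⟨-Real.sqrt b, by simp⟩

theorem posEmbedding_apply (b : ℕ) (s : ℤ√(b : ℤ)) :
    posEmbedding b s = s.re + s.im * Real.sqrt b := by
  simp [posEmbedding]

theorem negEmbedding_apply (b : ℕ) (s : ℤ√(b : ℤ)) :
    negEmbedding b s = s.re - s.im * Real.sqrt b := by
  simp [negEmbedding, sub_eq_add_neg]

theorem finite_bounded_embeddings {b : ℕ} (hb : 1 ≤ b) (B : ℝ) :
    {s : ℤ√(b : ℤ) | |posEmbedding b s| ≤ B ∧ |negEmbedding b s| ≤ B}.Finite := by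
  have hinj : Function.Injective fun s : ℤ√(b : ℤ) => (s.re, s.im) := fun s t h =>
    Zsqrtd.ext (Prod.ext_iff.1 h).1 (Prod.ext_iff.1 h).2
  refine Set.Finite.of_finite_image
    (((Set.finite_Icc (-⌈B⌉) ⌈B⌉).prod (Set.finite_Icc (-⌈B⌉) ⌈B⌉)).subset ?_) hinj.injOn
  rintro _ ⟨s, ⟨h1, h2⟩, rfl⟩
  rw [posEmbedding_apply, abs_le] at h1
  rw [negEmbedding_apply, abs_le] at h2
  have hsqrt : 1 ≤ Real.sqrt b := Real.one_le_sqrt.2 (by exact_mod_cast hb)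
  have hre : |(s.re : ℝ)| ≤ B := abs_le.2 ⟨by linarith, by linarith⟩
  have him : |(s.im : ℝ)| ≤ B := by
    have h : |(s.im : ℝ) * Real.sqrt b| ≤ B := abs_le.2 ⟨by linarith, by linarith⟩
    rw [abs_mul, abs_of_pos (by linarith : 0 < Real.sqrt b)] at h
    exact (le_mul_of_one_le_right (abs_nonneg _) hsqrt).trans h
  have hre' : |s.re| ≤ ⌈B⌉ := by exact_mod_cast hre.trans (Int.le_ceil B)
  have him' : |s.im| ≤ ⌈B⌉ := by exact_mod_cast him.trans (Int.le_ceil B)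
  exact ⟨abs_le.1 hre', abs_le.1 him'⟩

theorem exists_mul_eq_of_mem_adjoin {b : ℕ} {c : ℝ}
    (hc : c ∈ Algebra.adjoin ℚ {Real.sqrt (b : ℝ)}) :
    ∃ r s : ℤ√(b : ℤ), posEmbedding b r ≠ 0 ∧ posEmbedding b r * c = posEmbedding b s := by
  induction hc using Algebra.adjoin_induction with
  | mem x hx =>
    refine ⟨1, ⟨0, 1⟩, by simp, ?_⟩
    rw [Set.mem_singleton_iff.1 hx, posEmbedding_apply b ⟨0, 1⟩]
    simp
  | algebraMap q =>
    refine ⟨(q.den : ℤ√(b : ℤ)), (q.num : ℤ√(b : ℤ)), ?_, ?_⟩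
    · rw [map_natCast]
      exact_mod_cast q.den_nz
    · rw [map_natCast, map_intCast, eq_ratCast]
      exact_mod_cast q.den_mul_eq_num
  | add x y _ _ hx hy =>
    obtain ⟨r, s, hr, h⟩ := hx
    obtain ⟨r', s', hr', h'⟩ := hy
    refine ⟨r * r', s * r' + r * s', by simp [hr, hr'], ?_⟩
    simp only [map_add, map_mul, ← h, ← h']
    ring
  | mul x y _ _ hx hy =>
    obtain ⟨r, s, hr, h⟩ := hx
    obtain ⟨r', s', hr', h'⟩ := hy
    refine ⟨r * r', s * s', by simp [hr, hr'], ?_⟩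
    simp only [map_mul, ← h, ← h']
    ring

/-- A unit `u = d + e√b` of norm `1` lies strictly between `1` and the trace `2d`, because the
conjugate of `u` is the inverse of `u`. -/
theorem unit_bounds {b d e : ℕ} (hd : 1 < d) (hde : d ^ 2 = b * e ^ 2 + 1) :
    1 < posEmbedding b ⟨d, e⟩ ∧ |negEmbedding b ⟨d, e⟩| < 1 ∧
      posEmbedding b ⟨d, e⟩ ≤ ((2 * d : ℕ) : ℝ) := by
  rw [posEmbedding_apply, negEmbedding_apply]
  push_cast
  have hd' : (1 : ℝ) < d := by exact_mod_cast hd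
  have hnorm : ((d : ℝ) - e * Real.sqrt b) * (d + e * Real.sqrt b) = 1 := by
    have h1 : (d : ℝ) ^ 2 = b * e ^ 2 + 1 := by exact_mod_cast hde
    have h2 : Real.sqrt b ^ 2 = b := Real.sq_sqrt (Nat.cast_nonneg b)
    linear_combination h1 - (e : ℝ) ^ 2 * h2
  have he : 0 ≤ (e : ℝ) * Real.sqrt b := by positivity
  have hu : 1 < (d : ℝ) + e * Real.sqrt b := by linarith
  have hpos : 0 < (d : ℝ) - e * Real.sqrt b := 
    pos_of_mul_pos_left (hnorm ▸ one_pos) (by linarith)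
  have hlt : (d : ℝ) - e * Real.sqrt b < 1 := by
    by_contra hge
    have := mul_lt_mul' (not_lt.1 hge) hu zero_le_one hpos
    linarith
  exact ⟨hu, by rwa [abs_of_pos hpos], by linarith⟩

/-- The square of a nontrivial solution of the Pell equation has large coordinates. -/
theorem exists_pell_solution {b : ℕ} (hb : 2 ≤ b) (hsq : ¬ IsSquare b) :
    ∃ d e : ℕ, 3 < d ∧ 3 < e ∧ d ^ 2 = b * e ^ 2 + 1 := by
  have hsq' : ¬ IsSquare (b : ℤ) := by
    rwa [Int.isSquare_natCast_iff]
  obtain ⟨x, y, hxy, hy⟩ := Pell.exists_of_not_isSquare (by omega) hsq'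
  have hxy' : x.natAbs ^ 2 = b * y.natAbs ^ 2 + 1 := by
    zify
    rw [sq_abs, sq_abs]
    linarith
  have hy1 : 1 ≤ y.natAbs := Int.natAbs_pos.2 hy
  generalize x.natAbs = m at *
  generalize y.natAbs = n at *
  have hm : 2 ≤ m := by nlinarith
  exact ⟨m ^ 2 + b * n ^ 2, 2 * m * n, by nlinarith, by nlinarith, by
    zify at hxy' ⊢
    linear_combination ((m : ℤ) ^ 2 - b * n ^ 2 + 1) * hxy'⟩

theorem isAutomaticWithConstants_of_pell {b d e : ℕ} (hb : 1 ≤ b) (hd : 1 < d)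
    (hde : d ^ 2 = b * e ^ 2 + 1) {C : Set ℝ}
    (hC : C ⊆ (Algebra.adjoin ℚ {Real.sqrt (b : ℝ)} : Subalgebra ℚ ℝ)) :
    (baseNaming (2 * d) (posEmbedding b ⟨d, e⟩)).IsAutomaticWithConstants C :=
  baseNaming_isAutomaticWithConstants (unit_bounds hd hde).1 (unit_bounds hd hde).2.1
    (finite_bounded_embeddings hb) (unit_bounds hd hde).2.2
    fun _ hc => exists_mul_eq_of_mem_adjoin (hC hc)

theorem mainTheorem8 (b : ℕ) (hb : 2 ≤ b) :
    (∃ (A : Type) (_ : Zero A) (R : RealNaming A),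
      R.IsAutomaticWithConstants (Algebra.adjoin ℚ {Real.sqrt (b : ℝ)} : Subalgebra ℚ ℝ)) ∧
    (¬ IsSquare b →
      (∃ d e : ℕ, 3 < d ∧ 3 < e ∧ d ^ 2 = b * e ^ 2 + 1) ∧
      ∀ d e : ℕ, 3 < d → 3 < e → d ^ 2 = b * e ^ 2 + 1 →
        ∀ u : ℝ, u = (d : ℝ) + (e : ℝ) * Real.sqrt (b : ℝ) →
          (∀ (N : ℕ) (w : OmegaWord (Digit N)),
            Summable fun k : ℤ => ((w.digit k : ℤ) : ℝ) * u ^ k) ∧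
          (baseNaming (2 * d) u).IsAutomaticWithConstants
            (Algebra.adjoin ℚ {Real.sqrt (b : ℝ)} : Subalgebra ℚ ℝ) ∧
          ∃ (σ : Type) (_ : Finite σ) (M : SignAutomaton (Digit (6 * d)) σ),
            M.DetectsSign (baseValue u)) := by
  refine ⟨?_, fun hsq => ⟨exists_pell_solution hb hsq, ?_⟩⟩
  · by_cases hsq : IsSquare b
    · -- The constants are rational, so that the base `3 + 2√2` serves.
      obtain ⟨m, rfl⟩ := hsq
      refine ⟨_, _, _, isAutomaticWithConstants_of_pell (b := 2) (d := 3) (e := 2) (by norm_num)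
        (by norm_num) (by norm_num) ?_⟩
      refine SetLike.coe_subset_coe.2 (Algebra.adjoin_le (Set.singleton_subset_iff.2 ?_))
      rw [Nat.cast_mul, Real.sqrt_mul_self (Nat.cast_nonneg m)]
      exact natCast_mem _ m
    · obtain ⟨d, e, hd, -, hde⟩ := exists_pell_solution hb hsq
      exact ⟨_, _, _, isAutomaticWithConstants_of_pell (by omega) (by omega) hde subset_rfl⟩
  · intro d e hd _ hde u hu
    have hu' : u = posEmbedding b ⟨d, e⟩ := by
      rw [hu, posEmbedding_apply]
      simp
    have hbd := unit_bounds (b := b) (d := d) (e := e) (by omega) hde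
    rw [hu']
    exact ⟨fun N w => summable_digits hbd.1 w,
      isAutomaticWithConstants_of_pell (by omega) (by omega) hde subset_rfl,
      baseNaming_detectsSign hbd.1 hbd.2.1 (finite_bounded_embeddings (by omega)) _⟩
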